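/- Let $p_0\in(0,1)$. There is a constant $C>0$, depending only on $p_0$, such that the following holds for every $p\in(0,p_0]$, every $n\in\mathbb N$ and all $\epsilon,\delta\in(0,1)$. Let $X_1,\dots,X_n$ be uniformly distributed on $[-1,1]$ and let $M_1,\dots,M_n$ be $\{0,1\}$-valued Bernoulli random variables with $\mathbb P(M_i=1)=p$, all $2n$ variables $X_1,\dots,X_n,M_1,\dots,M_n$ being independent. If $$ n \;\ge\; C\,\frac{1}{\log\!\big(1/(1-p)\big)}\,\log\!\left(\frac{1}{\min(\delta,\epsilon)}\right), $$ then for every $z\in[-1,1]$, with probability at least $1-\delta$ there exists a (random) subset $I\subseteq\{1,\dots,n\}$ with $$ \Big|\,z-\sum_{i\in I} M_iX_i\,\Big|\le\epsilon , $$ that is, $\mathbb P\big(\exists I\subseteq\{1,\dots,n\}:\ |z-\sum_{i\in I}M_iX_i|\le\epsilon\big)\ge 1-\delta$ for each $z\in[-1,1]$. -/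

import Mathlib

open MeasureTheory ProbabilityTheory

/-!
The summands `Y i = M i * X i` are independent with common law `maskedLaw p`, and the set of points
reachable from `A = [-m, m]` by their subset sums grows, one summand at a time, from `A` to
`grow A y = A ∪ (A + y)`.

Let `v` be the length of the part of `A` in the core `[-1/2, 1/2]`. Two points of the core differ by
an element of `[-1, 1]`, so by Tonelli one uniform summand gains on average half of `(1 - v) * v`
(`setIntegral_gain`), while it never more than doubles `v`. By convexity of `v ↦ 1 / v` the ratio
`(1 - v) / v` of uncovered to covered length therefore shrinks on average by the factor `1 - p / 4`.
A single quantity thus controls both the growth of a small covered part and the exhaustion of the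
core. A fixed target `z ∈ [-1, 1]` lies within distance one of at least half of the core, so that
once most of the core is covered each summand reaches `z` with probability bounded below by a
multiple of `p`. Adding four times the ratio to the indicator that `z` is missed gives a potential
whose mean shrinks by the factor `1 - p / 8` in each step (`exists_potential_grow_le`). Induction on
the number of summands, which peels off the first one and enlarges the initial set, bounds the
probability to miss `z` by `exp (-(n * p / 8)) * (2 / m)` (`pi_notMem_reach_Icc_le`).

With `m = min δ ε` and `n * p ≥ 24 * log (1 / m)` this is at most `m` if `m` is small. If `m` is
close to one, the constant factor is too expensive, and subsets with at most one element suffice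
(`pi_notMem_reach_Icc_le_of_singletons`). Finally `log (1 / (1 - p)) ≤ p / (1 - p₀)` for `p ≤ p₀`,
and this comparison is where the dependence of the constant on `p₀` comes from.
-/

namespace RandomSubsetSum

open Set

/-! ### Reachable points -/

/-- The points that lie in `A` after subtraction of some subset sum of the entries of `y`. -/
def reach (A : Set ℝ) {n : ℕ} (y : Fin n → ℝ) : Set ℝ :=
  {w | ∃ I : Finset (Fin n), w - ∑ i ∈ I, y i ∈ A}

/-- The points reachable from `A` when a single summand `y` may be used. -/
def grow (A : Set ℝ) (y : ℝ) : Set ℝ := A ∪ {w | w - y ∈ A}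

/-- The points of `[-1/2, 1/2]`: two of them differ by an element of `[-1, 1]`, the support of
the uniform summands. -/
def core : Set ℝ := Icc (-1 / 2) (1 / 2)

/-- The length of the part of `A` in the core. -/
noncomputable def mass (A : Set ℝ) : ℝ := volume.real (A ∩ core)

/-- The length of the points of the core outside `A` that translating the part of `A` in the core
by `y` covers. Ignoring the rest of `A` keeps the gain below the mass. -/
noncomputable def gain (A : Set ℝ) (y : ℝ) : ℝ :=
  volume.real {w | w ∈ core \ A ∧ w - y ∈ A ∩ core}

lemma reach_zero (A : Set ℝ) (y : Fin 0 → ℝ) : reach A y = A := by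
  ext w
  simp only [reach, mem_ofPred_eq, Finset.sum_of_isEmpty, sub_zero,
    exists_const]

lemma reach_succ (A : Set ℝ) {n : ℕ} (y : Fin (n + 1) → ℝ) :
    reach A y = reach (grow A (y 0)) (fun i => y i.succ) := by
  classical
  ext w
  simp only [reach, grow, mem_ofPred_eq, mem_union]
  constructor
  · rintro ⟨I, hI⟩
    refine ⟨Finset.univ.filter fun i => i.succ ∈ I, ?_⟩
    have h : ∑ i ∈ I, y i = (if (0 : Fin (n + 1)) ∈ I then y 0 else 0) +
        ∑ i ∈ Finset.univ.filter (fun i : Fin n => i.succ ∈ I), y i.succ := by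
      rw [Finset.sum_filter, ← Fin.sum_univ_succ (fun i => if i ∈ I then y i else 0)]
      simp
    rw [h] at hI
    split_ifs at hI
    · right
      convert hI using 1
      ring
    · left
      convert hI using 1
      ring
  · rintro ⟨I, hI | hI⟩
    · refine ⟨I.map (Fin.succEmb n), ?_⟩
      simpa using hI
    · refine ⟨Finset.cons 0 (I.map (Fin.succEmb n)) (by simp [Fin.succ_ne_zero]), ?_⟩
      rw [Finset.sum_cons, Finset.sum_map]
      convert hI using 1
      simp only [Fin.coe_succEmb]
      ring

lemma measurableSet_setOf_mem_reach {A : Set ℝ} (hA : MeasurableSet A) (n : ℕ) (z : ℝ) :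
    MeasurableSet {y : Fin n → ℝ | z ∈ reach A y} := by
  have : {y : Fin n → ℝ | z ∈ reach A y} =
      ⋃ I : Finset (Fin n), (fun y : Fin n → ℝ => z - ∑ i ∈ I, y i) ⁻¹' A := by
    ext y
    simp [reach]
  rw [this]
  exact MeasurableSet.iUnion fun I => (by fun_prop : Measurable _) hA

lemma measurableSet_core : MeasurableSet core := measurableSet_Icc

lemma measurableSet_grow {A : Set ℝ} (hA : MeasurableSet A) (y : ℝ) :
    MeasurableSet (grow A y) :=
  hA.union ((by fun_prop : Measurable fun w : ℝ => w - y) hA)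

lemma volume_core : volume core = 1 := by
  simp only [core, Real.volume_Icc]
  norm_num

lemma volume_inter_core_ne_top (A : Set ℝ) : volume (A ∩ core) ≠ ⊤ :=
  measure_ne_top_of_subset inter_subset_right (by simp [volume_core])

lemma mass_le_one (A : Set ℝ) : mass A ≤ 1 := by
  have := measureReal_mono (μ := volume) (inter_subset_right : A ∩ core ⊆ core)
    (by simp [volume_core])
  simpa [mass, measureReal_def, volume_core] using this

lemma volume_core_diff {A : Set ℝ} (hA : MeasurableSet A) :
    volume.real (core \ A) = 1 - mass A := by
  have h := measureReal_inter_add_sdiff (μ := volume) (s := core) hA (by simp [volume_core])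
  have h1 : volume.real core = 1 := by simp [measureReal_def, volume_core]
  rw [inter_comm] at h
  rw [mass]
  linarith

lemma gain_nonneg (A : Set ℝ) (y : ℝ) : 0 ≤ gain A y := measureReal_nonneg

/-- A translate is not longer than the original. -/
lemma gain_le_mass (A : Set ℝ) (y : ℝ) : gain A y ≤ mass A := by
  have h : volume ((fun w : ℝ => w - y) ⁻¹' (A ∩ core)) = volume (A ∩ core) := by
    simpa [sub_eq_add_neg] using measure_preimage_add_right volume (-y) (A ∩ core)
  have h2 : gain A y ≤ volume.real ((fun w : ℝ => w - y) ⁻¹' (A ∩ core)) :=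
    measureReal_mono (fun w hw => hw.2) (by rw [h]; exact volume_inter_core_ne_top A)
  rwa [measureReal_def, h, ← measureReal_def] at h2

lemma mass_add_gain_le {A : Set ℝ} (hA : MeasurableSet A) (y : ℝ) :
    mass A + gain A y ≤ mass (grow A y) := by
  have hm : MeasurableSet {w | w ∈ core \ A ∧ w - y ∈ A ∩ core} :=
    (measurableSet_core.diff hA).inter
      ((by fun_prop : Measurable fun w : ℝ => w - y) (hA.inter measurableSet_core))
  have hsub : {w | w ∈ core \ A ∧ w - y ∈ A ∩ core} ⊆ core := fun w hw => hw.1.1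
  rw [mass, gain, ← measureReal_union _ hm (volume_inter_core_ne_top A)
    (measure_ne_top_of_subset hsub (by simp [volume_core]))]
  · refine measureReal_mono ?_ (volume_inter_core_ne_top _)
    rintro w (hw | hw)
    · exact ⟨Or.inl hw.1, hw.2⟩
    · exact ⟨Or.inr hw.2.1, hw.1.1⟩
  · exact Set.disjoint_left.2 fun w hw hw' => hw'.1.2 hw.1

lemma measurableSet_gain {A : Set ℝ} (hA : MeasurableSet A) :
    MeasurableSet {q : ℝ × ℝ | q.2 ∈ core \ A ∧ q.2 - q.1 ∈ A ∩ core} :=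
  (measurable_snd (measurableSet_core.diff hA)).inter
    ((by fun_prop : Measurable fun q : ℝ × ℝ => q.2 - q.1) (hA.inter measurableSet_core))

lemma measurable_gain {A : Set ℝ} (hA : MeasurableSet A) : Measurable (gain A) :=
  (measurable_measure_prodMk_left (ν := volume) (measurableSet_gain hA)).ennreal_toReal

lemma integrable_gain {A : Set ℝ} (hA : MeasurableSet A) (μ : Measure ℝ) [IsFiniteMeasure μ] :
    Integrable (gain A) μ := by
  refine Integrable.of_bound (measurable_gain hA).aestronglyMeasurable 1 (ae_of_all _ fun y => ?_)
  rw [Real.norm_of_nonneg (gain_nonneg A y)]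
  exact (gain_le_mass A y).trans (mass_le_one A)

/-- By Tonelli, the average gain is a product: every pair of an uncovered and a covered point of
the core is matched by exactly one translation, whose length is at most one. -/
lemma setIntegral_gain {A : Set ℝ} (hA : MeasurableSet A) :
    ∫ y in Icc (-1 : ℝ) 1, gain A y = (1 - mass A) * mass A := by
  have hs := measurableSet_gain hA
  have key : ∫⁻ y in Icc (-1 : ℝ) 1, volume {w | w ∈ core \ A ∧ w - y ∈ A ∩ core} =
      volume (core \ A) * volume (A ∩ core) := by
    have h1 := Measure.prod_apply (μ := volume.restrict (Icc (-1 : ℝ) 1)) (ν := volume) hs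
    have h2 := Measure.prod_apply_symm (μ := volume.restrict (Icc (-1 : ℝ) 1)) (ν := volume) hs
    refine (h1.symm.trans h2).trans ?_
    have h3 : ∀ w : ℝ, (volume.restrict (Icc (-1 : ℝ) 1))
        ((fun y => (y, w)) ⁻¹' {q : ℝ × ℝ | q.2 ∈ core \ A ∧ q.2 - q.1 ∈ A ∩ core}) =
        (core \ A).indicator (fun _ => volume (A ∩ core)) w := by
      intro w
      by_cases hw : w ∈ core \ A
      · rw [indicator_of_mem hw]
        have h4 : (fun y => (y, w)) ⁻¹' {q : ℝ × ℝ | q.2 ∈ core \ A ∧ q.2 - q.1 ∈ A ∩ core} =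
            (fun y => w - y) ⁻¹' (A ∩ core) := by
          ext y
          simp only [mem_preimage, mem_ofPred_eq, hw, true_and]
        have hm : MeasurableSet ((fun y => w - y) ⁻¹' (A ∩ core)) :=
          (by fun_prop : Measurable fun y : ℝ => w - y) (hA.inter measurableSet_core)
        rw [h4, Measure.restrict_apply hm, inter_eq_left.2]
        · exact (Measure.measurePreserving_sub_left volume w).measure_preimage
            (hA.inter measurableSet_core).nullMeasurableSet
        · intro y hy
          have h5 := hw.1
          have h6 := hy.2
          simp only [core, mem_Icc] at h5 h6 ⊢
          constructor <;> linarith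
      · rw [indicator_of_notMem hw]
        convert measure_empty (μ := volume.restrict (Icc (-1 : ℝ) 1)) using 2
        ext y
        simp only [mem_preimage, mem_ofPred_eq, hw, false_and, mem_empty_iff_false]
    rw [lintegral_congr h3, lintegral_indicator (measurableSet_core.diff hA), setLIntegral_const,
      mul_comm]
  have h := integral_toReal (μ := volume.restrict (Icc (-1 : ℝ) 1))
    (measurable_measure_prodMk_left (ν := volume) hs).aemeasurable
    (ae_of_all _ fun y => (measure_ne_top_of_subset
      (fun w hw => hw.1.1 : _ ⊆ core) (by simp [volume_core])).lt_top)
  refine h.trans ?_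
  refine (congrArg ENNReal.toReal key).trans ?_
  rw [ENNReal.toReal_mul, ← measureReal_def, ← measureReal_def, volume_core_diff hA, mass]

/-! ### The law of a masked summand -/

/-- The law of `M X` for `X` uniform on `[-1, 1]` and `M` an independent Bernoulli variable with
parameter `p`. -/
noncomputable def maskedLaw (p : unitInterval) : Measure ℝ :=
  unitInterval.toNNReal p • cond volume (Icc (-1 : ℝ) 1) +
    unitInterval.toNNReal (unitInterval.symm p) • Measure.dirac 0

lemma isProbabilityMeasure_uniform : IsProbabilityMeasure (cond volume (Icc (-1 : ℝ) 1)) :=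
  cond_isProbabilityMeasure_of_finite (by simp [Real.volume_Icc]) (by simp [Real.volume_Icc])

lemma maskedLaw_eq_map (p : unitInterval) :
    ((cond volume (Icc (-1 : ℝ) 1)).prod (bernoulliMeasure (1 : ℝ) 0 p)).map
      (fun q => q.2 * q.1) = maskedLaw p := by
  have := isProbabilityMeasure_uniform
  have hmul : Measurable fun q : ℝ × ℝ => q.2 * q.1 := by fun_prop
  rw [bernoulliMeasure_def, Measure.prod_add, Measure.prod_smul_right, Measure.prod_smul_right,
    Measure.prod_dirac, Measure.prod_dirac, Measure.map_add _ _ hmul, Measure.map_smul,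
    Measure.map_smul, Measure.map_map hmul (by fun_prop), Measure.map_map hmul (by fun_prop)]
  have h1 : (fun q : ℝ × ℝ => q.2 * q.1) ∘ (fun x : ℝ => (x, (1 : ℝ))) = id := by
    ext x
    simp
  have h0 : (fun q : ℝ × ℝ => q.2 * q.1) ∘ (fun x : ℝ => (x, (0 : ℝ))) = fun _ => 0 := by
    ext x
    simp
  rw [h1, h0, Measure.map_id, Measure.map_const, measure_univ, one_smul, maskedLaw]

instance (p : unitInterval) : IsProbabilityMeasure (maskedLaw p) := by
  have := isProbabilityMeasure_uniform
  rw [← maskedLaw_eq_map]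
  exact Measure.isProbabilityMeasure_map (by fun_prop)

lemma cond_uniform_eq : cond volume (Icc (-1 : ℝ) 1) =
    (2 : ENNReal)⁻¹ • volume.restrict (Icc (-1 : ℝ) 1) := by
  rw [ProbabilityTheory.cond, Real.volume_Icc]
  norm_num

lemma integral_maskedLaw (p : unitInterval) {f : ℝ → ℝ}
    (hf : IntegrableOn f (Icc (-1 : ℝ) 1)) :
    ∫ y, f y ∂maskedLaw p =
      p * (1 / 2 * ∫ y in Icc (-1 : ℝ) 1, f y) + (1 - p) * f 0 := by
  have hu : Integrable f (cond volume (Icc (-1 : ℝ) 1)) := by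
    rw [cond_uniform_eq]
    exact Integrable.smul_measure hf (by simp)
  have hd : Integrable f (Measure.dirac (0 : ℝ)) :=
    integrable_dirac (by simp)
  rw [maskedLaw, integral_add_measure (hu.smul_measure_nnreal) (hd.smul_measure_nnreal),
    integral_smul_nnreal_measure, integral_smul_nnreal_measure, integral_dirac, cond_uniform_eq,
    integral_smul_measure]
  simp [NNReal.smul_def]

lemma maskedLaw_real_ge (p : unitInterval) {s : Set ℝ} (hs : MeasurableSet s) :
    p / 2 * volume.real (s ∩ Icc (-1 : ℝ) 1) ≤ (maskedLaw p).real s := by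
  have h := integral_maskedLaw p (f := s.indicator 1)
    ((integrable_const (1 : ℝ)).indicator hs)
  rw [integral_indicator_one hs, integral_indicator_one hs, measureReal_restrict_apply hs] at h
  have h0 : 0 ≤ (1 - (p : ℝ)) * s.indicator (1 : ℝ → ℝ) 0 :=
    mul_nonneg (by linarith [p.2.2]) (indicator_nonneg (by simp) 0)
  rw [h]
  linarith

/-- The joint law of the masked summands is the product of their common law. -/
lemma map_masked_eq_pi {Ω : Type*} {mΩ : MeasurableSpace Ω} {P : Measure Ω}
    [IsProbabilityMeasure P] {p : unitInterval} {n : ℕ} {X M : Fin n → Ω → ℝ}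
    (hXm : ∀ i, Measurable (X i)) (hMm : ∀ i, Measurable (M i))
    (hX : ∀ i, pdf.IsUniform (X i) (Icc (-1 : ℝ) 1) P volume)
    (hM : ∀ i, HasLaw (M i) (bernoulliMeasure (1 : ℝ) 0 p) P)
    (hind : iIndepFun (fun j : Fin n ⊕ Fin n => Sum.elim X M j) P) :
    P.map (fun ω i => M i ω * X i ω) = Measure.pi fun _ : Fin n => maskedLaw p := by
  have := isProbabilityMeasure_uniform
  have hm : ∀ j : Fin n ⊕ Fin n, Measurable (Sum.elim X M j) := by
    rintro (i | i)
    · exact hXm i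
    · exact hMm i
  have hprob : ∀ j : Fin n ⊕ Fin n, IsProbabilityMeasure (P.map (Sum.elim X M j)) :=
    fun j => Measure.isProbabilityMeasure_map (hm j).aemeasurable
  have h1 := hind.map_fun_eq_pi_map fun j => (hm j).aemeasurable
  have h2 := (measurePreserving_sumPiEquivProdPi
    (fun j : Fin n ⊕ Fin n => P.map (Sum.elim X M j))).map_eq
  rw [← h1, Measure.map_map (MeasurableEquiv.measurable _) (measurable_pi_lambda _ hm)] at h2
  have h3 : ∀ i, P.map (X i) = cond volume (Icc (-1 : ℝ) 1) := hX
  have h4 : ∀ i, P.map (M i) = bernoulliMeasure (1 : ℝ) 0 p := fun i => (hM i).map_eq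
  simp only [Sum.elim_inl, Sum.elim_inr, h3, h4] at h2
  have h5 := (measurePreserving_arrowProdEquivProdArrow ℝ ℝ (Fin n)
    (fun _ => cond volume (Icc (-1 : ℝ) 1)) (fun _ => bernoulliMeasure (1 : ℝ) 0 p)).symm.map_eq
  rw [← h2, Measure.map_map (MeasurableEquiv.measurable _)
    ((MeasurableEquiv.measurable _).comp (measurable_pi_lambda _ hm))] at h5
  have h6 := Measure.pi_map_pi (μ := fun _ : Fin n =>
    (cond volume (Icc (-1 : ℝ) 1)).prod (bernoulliMeasure (1 : ℝ) 0 p))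
    (f := fun _ q => q.2 * q.1) (fun _ => by fun_prop)
    (hμ := fun _ => by rw [maskedLaw_eq_map]; infer_instance)
  simp only [maskedLaw_eq_map] at h6
  rw [← h6, ← h5, Measure.map_map (by fun_prop)
    ((MeasurableEquiv.measurable _).comp
      ((MeasurableEquiv.measurable _).comp (measurable_pi_lambda _ hm)))]
  rfl

/-! ### Decay of the potential -/

open Classical in
/-- The potential of a set `A` with respect to a target `z`: whether `z` is missed, plus four times
the ratio of the uncovered to the covered length of the core. -/
noncomputable def potential (z : ℝ) (A : Set ℝ) : ℝ :=
  (if z ∈ A then 0 else 1) + 4 * (1 / mass A - 1)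

/-- Since the mass at most doubles, the convex function `1 / v` may be replaced by its chord over
`[v, 2 * v]`, which makes the bound affine in the gain. -/
lemma one_div_mass_grow_le {A : Set ℝ} (hA : MeasurableSet A) (h0 : 0 < mass A) (y : ℝ) :
    1 / mass (grow A y) ≤ 1 / mass A * (1 - gain A y / (2 * mass A)) := by
  have h1 := mass_add_gain_le hA y
  have h2 := gain_nonneg A y
  have h3 := gain_le_mass A y
  have h4 : 1 / mass (grow A y) ≤ 1 / (mass A + gain A y) :=
    one_div_le_one_div_of_le (by linarith) h1
  refine h4.trans ?_
  have h5 : 1 / mass A * (1 - gain A y / (2 * mass A)) =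
      (2 * mass A - gain A y) / (2 * mass A ^ 2) := by
    field_simp
  rw [h5, div_le_div_iff₀ (by linarith) (by positivity)]
  nlinarith

lemma maskedLaw_notMem_grow_le {A : Set ℝ} (hA : MeasurableSet A) (p : unitInterval) {z : ℝ}
    (hz : z ∈ Icc (-1 : ℝ) 1) (hzA : z ∉ A) :
    (maskedLaw p).real {y | z ∉ grow A y} ≤ 1 - p / 2 * (mass A - 1 / 2) := by
  have hm : MeasurableSet {y : ℝ | z - y ∈ A} := (by fun_prop : Measurable fun y : ℝ => z - y) hA
  have h1 : {y | z ∉ grow A y} = {y : ℝ | z - y ∈ A}ᶜ := by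
    ext y
    simp [grow, hzA]
  rw [h1, probReal_compl_eq_one_sub hm]
  have h2 := maskedLaw_real_ge p hm
  have hmA : MeasurableSet (A ∩ Icc (z - 1) (z + 1)) := hA.inter measurableSet_Icc
  have h3 : volume.real ({y : ℝ | z - y ∈ A} ∩ Icc (-1 : ℝ) 1) =
      volume.real (A ∩ Icc (z - 1) (z + 1)) := by
    rw [← (Measure.measurePreserving_sub_left volume z).measureReal_preimage
      hmA.nullMeasurableSet]
    congr 1
    ext y
    simp only [mem_inter_iff, mem_ofPred_eq, mem_Icc, mem_preimage]
    constructor <;> rintro ⟨h, h', h''⟩ <;> refine ⟨h, ?_, ?_⟩ <;> linarith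
  -- At most half of the core is at a distance larger than one from `z`.
  have h4 : mass A ≤ volume.real (A ∩ Icc (z - 1) (z + 1)) + 1 / 2 := by
    have hfin : volume (A ∩ Icc (z - 1) (z + 1)) ≠ ⊤ :=
      measure_ne_top_of_subset inter_subset_right (by simp [Real.volume_Icc])
    have hhalf : ∀ a : ℝ, volume.real (Icc a (a + 1 / 2)) = 1 / 2 := fun a => by
      rw [Real.volume_real_Icc_of_le (by linarith)]
      ring
    have hcover : ∀ a : ℝ, A ∩ core ⊆ A ∩ Icc (z - 1) (z + 1) ∪ Icc a (a + 1 / 2) →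
        mass A ≤ volume.real (A ∩ Icc (z - 1) (z + 1)) + 1 / 2 := fun a ha => by
      rw [← hhalf a]
      refine (measureReal_mono ha ?_).trans (measureReal_union_le _ _)
      exact (measure_union_lt_top hfin.lt_top (by simp [Real.volume_Icc])).ne
    rcases le_total 0 z with h | h
    · refine hcover (-1 / 2) fun w hw => ?_
      have hw2 := hw.2
      simp only [core, mem_Icc] at hw2
      by_cases h0 : w ≤ 0
      · right
        constructor <;> linarith
      · left
        exact ⟨hw.1, by linarith [hz.2], by linarith [hz.2]⟩
    · refine hcover 0 fun w hw => ?_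
      have hw2 := hw.2
      simp only [core, mem_Icc] at hw2
      by_cases h0 : 0 ≤ w
      · right
        constructor <;> linarith
      · left
        exact ⟨hw.1, by linarith [hz.1], by linarith [hz.1]⟩
  rw [h3] at h2
  have := mul_le_mul_of_nonneg_left h4 (by linarith [p.2.1] : 0 ≤ (p : ℝ) / 2)
  linarith

lemma measurableSet_setOf_mem_grow {A : Set ℝ} (hA : MeasurableSet A) (z : ℝ) :
    MeasurableSet {y | z ∈ grow A y} :=
  (MeasurableSet.const (z ∈ A)).union ((by fun_prop : Measurable fun y : ℝ => z - y) hA)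

lemma integral_gain {A : Set ℝ} (hA : MeasurableSet A) (p : unitInterval) :
    ∫ y, gain A y ∂maskedLaw p = p / 2 * ((1 - mass A) * mass A) := by
  have h0 : gain A 0 = 0 := by
    have : {w | w ∈ core \ A ∧ w - 0 ∈ A ∩ core} = ∅ := by
      ext w
      simp only [sub_zero, mem_ofPred_eq, mem_empty_iff_false, iff_false]
      exact fun h => h.1.2 h.2.1
    rw [gain, this, measureReal_empty]
  rw [integral_maskedLaw p (integrable_gain hA _), setIntegral_gain hA, h0]
  ring

lemma one_sub_le_one_div_sub_one {v : ℝ} (hv : 0 < v) : 1 - v ≤ 1 / v - 1 := by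
  have h1 : 1 / v - 1 - (1 - v) = (1 - v) ^ 2 / v := by
    field_simp
  have h2 : 0 ≤ (1 - v) ^ 2 / v := by positivity
  linarith

/-- The potential after one more summand is dominated by an integrable function whose mean is
smaller than the present potential by the factor `1 - p / 8`. -/
lemma exists_potential_grow_le {A : Set ℝ} (hA : MeasurableSet A) (h0 : 0 < mass A)
    (p : unitInterval) {z : ℝ} (hz : z ∈ Icc (-1 : ℝ) 1) :
    ∃ g : ℝ → ℝ, Integrable g (maskedLaw p) ∧ (∀ y, potential z (grow A y) ≤ g y) ∧
      ∫ y, g y ∂maskedLaw p ≤ (1 - p / 8) * potential z A := by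
  classical
  have hbm : MeasurableSet {y | z ∉ grow A y} := (measurableSet_setOf_mem_grow hA z).compl
  obtain ⟨b, hb⟩ : ∃ b : ℝ → ℝ, b = {y | z ∉ grow A y}.indicator 1 := ⟨_, rfl⟩
  have hbi : Integrable b (maskedLaw p) := hb ▸ (integrable_const (1 : ℝ)).indicator hbm
  have hB : ∫ y, b y ∂maskedLaw p = (maskedLaw p).real {y | z ∉ grow A y} :=
    hb ▸ integral_indicator_one hbm
  have hgi := integrable_gain hA (maskedLaw p)
  have hG := integral_gain hA p
  have hv1 := mass_le_one A
  have hgrow := one_div_mass_grow_le hA h0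
  have hmiss := maskedLaw_notMem_grow_le hA p hz
  obtain ⟨v, hv⟩ : ∃ v, v = mass A := ⟨_, rfl⟩
  rw [← hv] at h0 hG hv1 hgrow hmiss
  have hi1 : Integrable (fun y => b y + 4 * (1 / v - 1)) (maskedLaw p) :=
    hbi.fun_add (integrable_const (4 * (1 / v - 1)))
  have hi2 : Integrable (fun y => 2 / v ^ 2 * gain A y) (maskedLaw p) := hgi.const_mul (2 / v ^ 2)
  refine ⟨fun y => (b y + 4 * (1 / v - 1)) - 2 / v ^ 2 * gain A y, hi1.sub' hi2,
    fun y => ?_, ?_⟩ <;> beta_reduce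
  · have h2 : b y = if z ∈ grow A y then 0 else 1 := by
      rw [hb, indicator_apply]
      simp only [mem_ofPred_eq, Pi.one_apply, ite_not]
    have h3 : 1 / v * (1 - gain A y / (2 * v)) = 1 / v - 1 / (2 * v ^ 2) * gain A y := by
      field_simp
    have h4 : 2 / v ^ 2 * gain A y = 4 * (1 / (2 * v ^ 2) * gain A y) := by
      field_simp
      ring
    have h5 := hgrow y
    rw [h3] at h5
    rw [potential, ← h2, h4]
    linarith
  · have h6 : 2 / v ^ 2 * (p / 2 * ((1 - v) * v)) = p * (1 / v - 1) := by
      field_simp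
    rw [integral_sub hi1 hi2, integral_add hbi (integrable_const _), integral_const,
      integral_const_mul (2 / v ^ 2), hG, hB, potential, h6, ← hv, probReal_univ, one_smul]
    have hp := p.2.1
    have hinv := one_sub_le_one_div_sub_one h0
    have h8 : 0 ≤ (p : ℝ) * (1 / v - 1) := mul_nonneg hp (by linarith)
    have h9 := mul_le_mul_of_nonneg_left hinv hp
    by_cases hzA : z ∈ A
    · have : {y | z ∉ grow A y} = ∅ := by
        ext y
        simp [grow, hzA]
      rw [this, measureReal_empty, if_pos hzA]
      linarith
    · have h10 := hmiss hzA
      rw [if_neg hzA]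
      linarith

/-- The probability that `z` is missed decays exponentially, at a rate that does not depend on
the initial set. -/
lemma pi_notMem_reach_le (p : unitInterval) {z : ℝ} (hz : z ∈ Icc (-1 : ℝ) 1) (n : ℕ) :
    ∀ A : Set ℝ, MeasurableSet A → 0 < mass A →
      (Measure.pi fun _ : Fin n => maskedLaw p).real {y | z ∉ reach A y} ≤
        (1 - p / 8) ^ n * potential z A := by
  have hp8 : (0 : ℝ) ≤ 1 - p / 8 := by linarith [p.2.2]
  induction n with
  | zero =>
    intro A hA h0
    have h1 : 0 ≤ 1 / mass A - 1 := by
      have := one_le_one_div h0 (mass_le_one A)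
      linarith
    simp only [reach_zero, pow_zero, one_mul, potential]
    split_ifs with hzA
    · simp only [hzA, not_true_eq_false, ofPred_false, measureReal_empty]
      linarith
    · refine measureReal_le_one.trans ?_
      linarith
  | succ n ih =>
    intro A hA h0
    set μ := maskedLaw p
    obtain ⟨g, hgi, hg, hgint⟩ := exists_potential_grow_le hA h0 p hz
    have hmp := measurePreserving_piFinSuccAbove (fun _ : Fin (n + 1) => μ) 0
    have hms : MeasurableSet {q : ℝ × (Fin n → ℝ) | z ∉ reach (grow A q.1) q.2} := by
      have h1 := (MeasurableEquiv.piFinSuccAbove (fun _ : Fin (n + 1) => ℝ) 0).symm.measurable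
        (measurableSet_setOf_mem_reach hA (n + 1) z).compl
      convert h1 using 1
      ext q
      simp only [mem_ofPred_eq, mem_preimage, mem_compl_iff, reach_succ]
      rfl
    have h2 : {y : Fin (n + 1) → ℝ | z ∉ reach A y} =
        (MeasurableEquiv.piFinSuccAbove (fun _ : Fin (n + 1) => ℝ) 0) ⁻¹'
          {q : ℝ × (Fin n → ℝ) | z ∉ reach (grow A q.1) q.2} := by
      ext y
      simp only [mem_ofPred_eq, mem_preimage, reach_succ]
      rfl
    rw [h2, hmp.measureReal_preimage hms.nullMeasurableSet, measureReal_def,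
      Measure.prod_apply hms,
      ← integral_toReal (measurable_measure_prodMk_left hms).aemeasurable
        (ae_of_all _ fun y => measure_lt_top _ _)]
    calc _ ≤ ∫ y, (1 - (p : ℝ) / 8) ^ n * g y ∂μ := by
          refine integral_mono_of_nonneg (ae_of_all _ fun y => ENNReal.toReal_nonneg)
            (hgi.const_mul _) (ae_of_all _ fun y => ?_)
          have h3 : 0 < mass (grow A y) := by
            linarith [mass_add_gain_le hA y, gain_nonneg A y]
          exact (ih (grow A y) (measurableSet_grow hA y) h3).trans
            (mul_le_mul_of_nonneg_left (hg y) (pow_nonneg hp8 n))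
      _ ≤ _ := by
          rw [integral_const_mul, pow_succ, mul_assoc]
          exact mul_le_mul_of_nonneg_left hgint (pow_nonneg hp8 n)

/-! ### Failure probabilities -/

/-- The estimate for a small tolerance, from the decay of the potential of `[-m, m]`. -/
lemma pi_notMem_reach_Icc_le (p : unitInterval) {z : ℝ} (hz : z ∈ Icc (-1 : ℝ) 1) (n : ℕ)
    {m : ℝ} (hm : 0 < m) (hm' : m ≤ 1 / 2) :
    (Measure.pi fun _ : Fin n => maskedLaw p).real {y | z ∉ reach (Icc (-m) m) y} ≤
      Real.exp (-(n * p / 8)) * (2 / m) := by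
  have hmass : mass (Icc (-m) m) = 2 * m := by
    have : Icc (-m) m ∩ core = Icc (-m) m :=
      inter_eq_left.2 (Icc_subset_Icc (by linarith) (by linarith))
    rw [mass, this, Real.volume_real_Icc_of_le (by linarith)]
    ring
  refine (pi_notMem_reach_le p hz n _ measurableSet_Icc (by linarith)).trans ?_
  have h1 : (1 - (p : ℝ) / 8) ^ n ≤ Real.exp (-(n * p / 8)) := by
    have h2 : 1 - (p : ℝ) / 8 ≤ Real.exp (-(p / 8)) := by
      linarith [Real.add_one_le_exp (-((p : ℝ) / 8))]
    refine (pow_le_pow_left₀ (by linarith [p.2.2]) h2 n).trans_eq ?_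
    rw [← Real.exp_nat_mul]
    congr 1
    ring
  have h3 : potential z (Icc (-m) m) ≤ 2 / m := by
    have h5 : 4 * (1 / (2 * m) - 1) = 2 / m - 4 := by
      field_simp
      ring
    rw [potential, hmass, h5]
    split_ifs <;> linarith
  have h4 : 0 ≤ (2 : ℝ) / m := by positivity
  calc _ ≤ (1 - (p : ℝ) / 8) ^ n * (2 / m) :=
        mul_le_mul_of_nonneg_left h3 (pow_nonneg (by linarith [p.2.2]) n)
    _ ≤ _ := mul_le_mul_of_nonneg_right h1 h4

/-- The estimate for a large tolerance, where subsets with at most one element suffice. -/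
lemma pi_notMem_reach_Icc_le_of_singletons (p : unitInterval) {z : ℝ} (hz : z ∈ Icc (-1 : ℝ) 1)
    (n : ℕ) {m : ℝ} (hm : 0 < m) :
    (Measure.pi fun _ : Fin n => maskedLaw p).real {y | z ∉ reach (Icc (-m) m) y} ≤
      Real.exp (-(n * p * m / 2)) := by
  by_cases hzm : |z| ≤ m
  · have : {y : Fin n → ℝ | z ∉ reach (Icc (-m) m) y} = ∅ := by
      ext y
      simp only [mem_ofPred_eq, mem_empty_iff_false, iff_false, not_not]
      exact ⟨∅, by simpa using abs_le.1 hzm⟩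
    rw [this, measureReal_empty]
    positivity
  set s : Set ℝ := Icc (z - m) (z + m) with hs
  have h1 : {y : Fin n → ℝ | z ∉ reach (Icc (-m) m) y} ⊆ univ.pi fun _ => sᶜ := by
    intro y hy i _ hi
    refine hy ⟨{i}, ?_⟩
    rw [hs, mem_Icc] at hi
    rw [Finset.sum_singleton, mem_Icc]
    constructor <;> linarith
  have h2 : m ≤ volume.real (s ∩ Icc (-1 : ℝ) 1) := by
    have hfin : volume (s ∩ Icc (-1 : ℝ) 1) ≠ ⊤ :=
      measure_ne_top_of_subset inter_subset_right (by simp [Real.volume_Icc])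
    have hcover : ∀ a : ℝ, Icc a (a + m) ⊆ s ∩ Icc (-1 : ℝ) 1 →
        m ≤ volume.real (s ∩ Icc (-1 : ℝ) 1) := fun a ha => by
      have := measureReal_mono (μ := volume) ha hfin
      rw [Real.volume_real_Icc_of_le (by linarith)] at this
      linarith
    -- The half of the interval that points from `z` towards the origin stays inside `[-1, 1]`.
    rcases le_total 0 z with h | h
    · rw [abs_of_nonneg h] at hzm
      refine hcover (z - m) fun w hw => ⟨⟨hw.1, by linarith [hw.2]⟩, ?_, ?_⟩ <;>
        linarith [hw.1, hw.2, hz.2]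
    · rw [abs_of_nonpos h] at hzm
      refine hcover z fun w hw => ⟨⟨by linarith [hw.1], hw.2⟩, ?_, ?_⟩ <;>
        linarith [hw.1, hw.2, hz.1]
  have hms : MeasurableSet s := measurableSet_Icc
  have h3 : (maskedLaw p).real sᶜ ≤ Real.exp (-(p * m / 2)) := by
    rw [probReal_compl_eq_one_sub hms]
    have h4 := maskedLaw_real_ge p hms
    have h5 := mul_le_mul_of_nonneg_left h2 (by linarith [p.2.1] : 0 ≤ (p : ℝ) / 2)
    linarith [Real.add_one_le_exp (-((p : ℝ) * m / 2))]
  calc _ ≤ (Measure.pi fun _ : Fin n => maskedLaw p).real (univ.pi fun _ => sᶜ) :=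
        measureReal_mono h1
    _ = (maskedLaw p).real sᶜ ^ n := by
        simp [measureReal_def, Measure.pi_pi]
    _ ≤ Real.exp (-(p * m / 2)) ^ n := pow_le_pow_left₀ measureReal_nonneg h3 n
    _ = _ := by
        rw [← Real.exp_nat_mul]
        congr 1
        ring

/-- The failure probability is at most the tolerance `m` as soon as `n p ≥ 24 log (1 / m)`. -/
lemma pi_notMem_reach_Icc_le_self (p : unitInterval) {z : ℝ} (hz : z ∈ Icc (-1 : ℝ) 1)
    {n : ℕ} {m : ℝ} (hm : 0 < m) (hm' : m < 1) (hn : 24 * Real.log (1 / m) ≤ n * p) :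
    (Measure.pi fun _ : Fin n => maskedLaw p).real {y | z ∉ reach (Icc (-m) m) y} ≤ m := by
  have hlog : Real.log (1 / m) = -Real.log m := by rw [one_div, Real.log_inv]
  have hneg : Real.log m < 0 := Real.log_neg hm hm'
  rw [hlog] at hn
  -- Below `1 / 12` the bound `2 * m ^ 2` for small tolerances is at most `m`; above, the rate
  -- `24 * m / 2` in the bound from singletons is at least one.
  rcases le_or_gt (1 / 12) m with h | h
  · refine (pi_notMem_reach_Icc_le_of_singletons p hz n hm).trans ?_
    rw [← Real.le_log_iff_exp_le hm]
    have h1 : 0 ≤ -Real.log m := by linarith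
    have h2 := mul_le_mul_of_nonneg_right hn hm.le
    nlinarith
  · refine (pi_notMem_reach_Icc_le p hz n hm (by linarith)).trans ?_
    have h1 : Real.exp (-(n * p / 8)) ≤ m ^ 3 := by
      rw [← Real.le_log_iff_exp_le (by positivity), Real.log_pow]
      push_cast
      linarith
    calc _ ≤ m ^ 3 * (2 / m) := mul_le_mul_of_nonneg_right h1 (by positivity)
      _ = 2 * m * m := by
          field_simp
      _ ≤ 1 * m := by
          gcongr
          linarith
      _ = m := one_mul m

/-- On `(0, p₀]`, the function `log (1 / (1 - p))` is comparable to `p`. -/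
lemma log_one_div_one_sub_le {p p₀ : ℝ} (hp : 0 < p) (hp' : p ≤ p₀) (hp₀ : p₀ < 1) :
    0 < Real.log (1 / (1 - p)) ∧ Real.log (1 / (1 - p)) ≤ p / (1 - p₀) := by
  have h1 : 0 < 1 - p := by linarith
  constructor
  · exact Real.log_pos (by rw [lt_div_iff₀ h1]; linarith)
  · have h2 := Real.log_le_sub_one_of_pos (by positivity : 0 < 1 / (1 - p))
    have h3 : 1 / (1 - p) - 1 = p / (1 - p) := by
      field_simp
      ring
    rw [h3] at h2
    exact h2.trans (div_le_div_of_nonneg_left hp.le (by linarith) (by linarith))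

end RandomSubsetSum

/-- Subset sum approximation with randomly missing summands. The random subset is expressed by the
event that some `I ⊆ [n]` (which may depend on the outcome) approximates `z`. All `2 n` variables
are jointly independent. The constant `C` depends only on an upper bound `p₀ < 1` for `p`. -/
theorem mainTheorem3 (p₀ : ℝ) (hp₀ : 0 < p₀) (hp₀' : p₀ < 1) :
    ∃ C : ℝ, 0 < C ∧
      ∀ (Ω : Type*) (mΩ : MeasurableSpace Ω) (P : Measure Ω) (_hP : IsProbabilityMeasure P)
        (p : unitInterval) (_hp : 0 < (p : ℝ)) (_hp' : (p : ℝ) ≤ p₀)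
        (n : ℕ) (X M : Fin n → Ω → ℝ)
        (_hXm : ∀ i, Measurable (X i)) (_hMm : ∀ i, Measurable (M i))
        (_hX : ∀ i, pdf.IsUniform (X i) (Set.Icc (-1 : ℝ) 1) P volume)
        (_hM : ∀ i, HasLaw (M i) (bernoulliMeasure (1 : ℝ) 0 p) P)
        (_hind : iIndepFun (fun j : Fin n ⊕ Fin n => Sum.elim X M j) P)
        (ε δ : ℝ) (_hε : 0 < ε) (_hε' : ε < 1) (_hδ : 0 < δ) (_hδ' : δ < 1)
        (_hn : C * (1 / Real.log (1 / (1 - (p : ℝ)))) * Real.log (1 / min δ ε) ≤ (n : ℝ))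
        (z : ℝ) (_hz : z ∈ Set.Icc (-1 : ℝ) 1),
        1 - δ ≤ P.real {ω | ∃ I : Finset (Fin n), |z - ∑ i ∈ I, M i ω * X i ω| ≤ ε} := by
  have h₀ : 0 < 1 - p₀ := by linarith
  refine ⟨24 / (1 - p₀), by positivity, ?_⟩
  intro Ω mΩ P _ p hp hp' n X M hXm hMm hX hM hind ε δ hε hε' hδ hδ' hn z hz
  set m := min δ ε with hm
  have hm0 : 0 < m := lt_min hδ hε
  have hm1 : m < 1 := (min_le_left _ _).trans_lt hδ'
  have hlog : 0 ≤ Real.log (1 / m) := Real.log_nonneg (one_le_one_div hm0 hm1.le)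
  obtain ⟨hpos, hle⟩ := RandomSubsetSum.log_one_div_one_sub_le hp hp' hp₀'
  set L := Real.log (1 / (1 - (p : ℝ)))
  have hnp : 24 * Real.log (1 / m) ≤ n * p := by
    have h1 : 24 / (1 - p₀) * Real.log (1 / m) ≤ n * L := by
      have h2 := mul_le_mul_of_nonneg_right hn hpos.le
      have h3 : 24 / (1 - p₀) * (1 / L) * Real.log (1 / m) * L =
          24 / (1 - p₀) * Real.log (1 / m) := by
        field_simp
      rwa [h3] at h2
    have h4 := h1.trans (mul_le_mul_of_nonneg_left hle (Nat.cast_nonneg n))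
    rw [div_mul_eq_mul_div, ← mul_div_assoc] at h4
    exact (div_le_div_iff_of_pos_right h₀).1 h4
  have hfail := RandomSubsetSum.pi_notMem_reach_Icc_le_self p hz hm0 hm1 hnp
  have hmY : Measurable fun ω (i : Fin n) => M i ω * X i ω :=
    measurable_pi_lambda _ fun i => (hMm i).mul (hXm i)
  have hreach := RandomSubsetSum.measurableSet_setOf_mem_reach
    (measurableSet_Icc : MeasurableSet (Set.Icc (-m) m)) n z
  have hprob : IsProbabilityMeasure (P.map fun ω (i : Fin n) => M i ω * X i ω) :=
    Measure.isProbabilityMeasure_map hmY.aemeasurable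
  rw [← RandomSubsetSum.map_masked_eq_pi hXm hMm hX hM hind] at hfail
  have hcompl := probReal_compl_eq_one_sub
    (μ := P.map fun ω (i : Fin n) => M i ω * X i ω) hreach
  have hfail' : 1 - m ≤ (P.map fun ω (i : Fin n) => M i ω * X i ω).real
      {y | z ∈ RandomSubsetSum.reach (Set.Icc (-m) m) y} := by
    have h : (P.map fun ω (i : Fin n) => M i ω * X i ω).real
        {y | z ∈ RandomSubsetSum.reach (Set.Icc (-m) m) y}ᶜ ≤ m := hfail
    linarith
  rw [map_measureReal_apply hmY hreach] at hfail'
  have hmδ : m ≤ δ := min_le_left _ _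
  refine (by linarith : 1 - δ ≤ 1 - m).trans (hfail'.trans (measureReal_mono ?_))
  rintro ω ⟨I, hI⟩
  exact ⟨I, (abs_le.2 hI).trans (min_le_right _ _)⟩
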